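/- Fix positive integers $d$ and $k$. Let $G_1$ be a finite connected graph with a distinguished set $S_1\subseteq V(G_1)$ of connecting vertices. Inductively, given a finite graph $G_n$ and a set $S_n\subseteq V(G_n)$ of connecting vertices, let $\widetilde G_n$ be the disjoint union of $k$ copies of $G_n$, the first copy being identified with $G_n$; in each copy the vertices corresponding to those of $S_n$ are called the connecting vertices of $\widetilde G_n$. Let $G_{n+1}$ be a connected graph obtained from $\widetilde G_n$ by adding edges both of whose endpoints are connecting vertices of $\widetilde G_n$, and let $S_{n+1}$ be a set of connecting vertices of $\widetilde G_n$ with $S_{n+1}\cap V(G_n)=\emptyset$. All vertex degrees in all the graphs $G_n$ are assumed to be at most $d$. The graph $G=\bigcup_{n\ge 1}G_n$ is called self-similar if $|S_n|/|V(G_n)|\to 0$ as $n\to\infty$. Let $G$ be a self-similar graph with vertex set $V$ and shortest path distance $d_G$. A bounded operator $\mathcal A$ on the real Hilbert space $L^2(V)$ is called pattern-invariant if there are an integer $r\ge 0$ and a kernel $A:V\times V\to\mathbb R$ such that $(\mathcal A f)(x)=\sum_{y\in V}A(x,y)f(y)$ for all $f\in L^2(V)$ and $x\in V$; $A(x,y)=0$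 whenever $d_G(x,y)>r$; and $A(x,y)=A(\psi(x),\psi(y))$ whenever $\psi$ is a graph isomorphism from the subgraph induced on the $r$-ball around $x$ onto the subgraph induced on the $r$-ball around $\psi(x)$, and $y$ lies in the $r$-ball around $x$. A Følner sequence is a sequence of non-empty finite sets $Q_n\subseteq V$ with $|\partial Q_n|/|Q_n|\to 0$, where $\partial Q$ is the set of vertices of $Q$ that have a neighbour outside $Q$. For a finite set $Q\subseteq V$ let $i_Q:L^2(Q)\to L^2(V)$ be extension by zero and let $p_Q:L^2(V)\to L^2(Q)$ be restriction. For a self-adjoint operator $\mathcal A$ and non-empty $Q$, let $N_{\mathcal A_Q}(\lambda)$, $\lambda\in\mathbb R$, be the number of eigenvalues, counted with multiplicity, of $p_Q\mathcal A\, i_Q$ that are at most $\lambda$, divided by $|Q|$. Theorem. Let $G$ be a self-similar graph and let $\mathcal A$ be a self-adjoint pattern-invariant operator on $L^2(V)$. Then there is a function $N_{\mathcal A}:\mathbb R\to\mathbb R$ such that for every Følner sequence $(Q_n)$ in $G$ the functions $N_{\mathcal A_{Q_n}}$ converge to $N_{\mathcal A}$ uniformly on $\mathbb R$. -/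

import Mathlib

open Filter Topology

noncomputable section

/-- A presentation of the graph `G` as the union of an increasing sequence of finite graphs
`graph 0 ⊆ graph 1 ⊆ ...`, where `graph (n + 1)` consists of `k` disjoint copies of `graph n`
(the first of them being `graph n` itself) together with some additional edges whose endpoints
are connecting vertices of the copies, and where all vertex degrees are at most `d`. -/
structure SelfSimilarPresentation {V : Type*} (G : SimpleGraph V) (d k : ℕ) where
  k_pos : 0 < k
  graph : ℕ → G.Subgraph
  /-- the set of connecting vertices of `graph n` -/
  conn : ℕ → Set V
  /-- `copy n (i, x)` is the vertex of the `i`-th copy of `graph n` that corresponds to `x` -/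
  copy : ∀ n, Fin k × (graph n).verts ≃ (graph (n + 1)).verts
  finite_zero : (graph 0).verts.Finite
  connected : ∀ n, (graph n).Connected
  degree_le : ∀ n, ∀ x ∈ (graph n).verts, ((graph n).neighborSet x).encard ≤ d
  conn_subset : ∀ n, conn n ⊆ (graph n).verts
  copy_first : ∀ n (x : (graph n).verts), (copy n (⟨0, k_pos⟩, x) : V) = x
  /-- every copy contains the edges of `graph n` -/
  adj_copy : ∀ n (i : Fin k) (x y : (graph n).verts), (graph n).Adj x y →
    (graph (n + 1)).Adj (copy n (i, x)) (copy n (i, y))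
  /-- every other edge joins two connecting vertices of the copies -/
  adj_new : ∀ n (i j : Fin k) (x y : (graph n).verts),
    (graph (n + 1)).Adj (copy n (i, x)) (copy n (j, y)) →
      (i = j ∧ (graph n).Adj x y) ∨ ((x : V) ∈ conn n ∧ (y : V) ∈ conn n)
  /-- the new connecting vertices are connecting vertices of the copies ... -/
  conn_succ_subset : ∀ n, ∀ v ∈ conn (n + 1),
    ∃ (i : Fin k) (x : (graph n).verts), (x : V) ∈ conn n ∧ v = copy n (i, x)
  /-- ... outside the first copy -/
  conn_succ_disjoint : ∀ n, Disjoint (conn (n + 1)) (graph n).verts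
  iSup_eq_top : ⨆ n, graph n = ⊤

/-- `G` is self-similar: it has a presentation as above in which the proportion of the
connecting vertices tends to `0`. -/
def IsSelfSimilar {V : Type*} (G : SimpleGraph V) : Prop :=
  ∃ (d k : ℕ) (P : SelfSimilarPresentation G d k),
    Tendsto (fun n => ((P.conn n).ncard : ℝ) / ((P.graph n).verts.ncard : ℝ)) atTop (𝓝 0)

/-- The closed ball of radius `r` around `x` in the shortest path distance. -/
def graphBall {V : Type*} (G : SimpleGraph V) (x : V) (r : ℕ) : Set V :=
  {y | G.edist x y ≤ r}

theorem mem_graphBall_self {V : Type*} (G : SimpleGraph V) (x : V) (r : ℕ) :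
    x ∈ graphBall G x r := by
  simp [graphBall]

/-- The operator `T` on `L²(V)` is given by a kernel `A` of finite propagation `r` that is invariant
under all rooted isomorphisms between the (full subgraphs on the) balls of radius `r`. -/
def IsPatternInvariant {V : Type*} (G : SimpleGraph V)
    (T : lp (fun _ : V => ℝ) 2 →L[ℝ] lp (fun _ : V => ℝ) 2) : Prop :=
  ∃ (r : ℕ) (A : V → V → ℝ),
    (∀ (f : lp (fun _ : V => ℝ) 2) (x : V), T f x = ∑' y, A x y * f y) ∧
    (∀ x y, (r : ℕ∞) < G.edist x y → A x y = 0) ∧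
    ∀ (x x' : V) (ψ : G.induce (graphBall G x r) ≃g G.induce (graphBall G x' r)),
      ψ ⟨x, mem_graphBall_self G x r⟩ = ⟨x', mem_graphBall_self G x' r⟩ →
      ∀ y : graphBall G x r, A x y = A x' (ψ y)

/-- The inner vertex boundary `∂Q`. -/
def innerBoundary {V : Type*} (G : SimpleGraph V) (Q : Finset V) : Set V :=
  {p | p ∈ Q ∧ ∃ q, q ∉ Q ∧ G.Adj p q}

def IsFolnerSeq {V : Type*} (G : SimpleGraph V) (Q : ℕ → Finset V) : Prop :=
  (∀ n, (Q n).Nonempty) ∧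
    Tendsto (fun n => ((innerBoundary G (Q n)).ncard : ℝ) / ((Q n).card : ℝ)) atTop (𝓝 0)

/-- The projection `p_Q : L²(V) → L²(Q)`. -/
def restrictTo {V : Type*} (Q : Finset V) : lp (fun _ : V => ℝ) 2 →ₗ[ℝ] EuclideanSpace ℝ Q where
  toFun f := WithLp.toLp 2 fun x => f x
  map_add' f g := by ext x; simp
  map_smul' c f := by ext x; simp

open Classical in
/-- The embedding `i_Q : L²(Q) → L²(V)`, extension by zero. -/
def extendByZero {V : Type*} (Q : Finset V) : EuclideanSpace ℝ Q →ₗ[ℝ] lp (fun _ : V => ℝ) 2 where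
  toFun f := ⟨fun x => if h : x ∈ Q then f ⟨x, h⟩ else 0, by
    refine (memℓp_zero (Q.finite_toSet.subset ?_)).of_exponent_ge zero_le
    intro x hx
    by_contra h
    exact hx (dif_neg h)⟩
  map_add' f g := by
    ext x
    rw [lp.coeFn_add, Pi.add_apply]
    by_cases h : x ∈ Q <;> simp [h]
  map_smul' c f := by
    ext x
    rw [lp.coeFn_smul, Pi.smul_apply]
    by_cases h : x ∈ Q <;> simp [h]

/-- The truncated operator `p_Q T i_Q` on `L²(Q)`. -/
def truncation {V : Type*} (T : lp (fun _ : V => ℝ) 2 →L[ℝ] lp (fun _ : V => ℝ) 2) (Q : Finset V) :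
    EuclideanSpace ℝ Q →ₗ[ℝ] EuclideanSpace ℝ Q :=
  restrictTo Q ∘ₗ (T : lp (fun _ : V => ℝ) 2 →ₗ[ℝ] lp (fun _ : V => ℝ) 2) ∘ₗ extendByZero Q

open Classical in
/-- The normalized spectral distribution function: the number of eigenvalues of `T` (roots of the
characteristic polynomial, with multiplicity) that are at most `t`, divided by the dimension. -/
def spectralDistribution {V : Type*} {Q : Finset V}
    (T : EuclideanSpace ℝ Q →ₗ[ℝ] EuclideanSpace ℝ Q) (t : ℝ) : ℝ :=
  (T.charpoly.roots.countP (fun μ => μ ≤ t) : ℝ) / (Q.card : ℝ)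

end

/-! Fix `n`, let `v` be the number of vertices of `graph n`, and let `b` be the number of those
within distance `r` of a connecting vertex. Any finite `Q` is covered by disjoint copies (tiles) of
`graph n`, attached to the rest of `G` only through connecting vertices. Tiles are connected, so a
tile that meets `Q` without lying in it contains a vertex of `∂Q`; hence all but at most `|∂Q| * v`
vertices of `Q` lie in tiles inside `Q`. Around a vertex of a tile far from the connecting vertices,
the `r`-ball of `G` stays in the tile and looks the same in every tile, so a pattern-invariant
kernel has the same row there (`IsTile.kernel_eq`, `IsTile.kernel_eq_zero`).

Eigenvalues up to `t` are counted variationally, by the largest dimension of a subspace on which the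
quadratic form is at most `t * ‖x‖ ^ 2`. Forcing functions to vanish at the `b` bad vertices costs
at most `b` dimensions per tile and decouples the tiles. Applied to the spectral subspaces below and
above `t`, this bounds the count for `Q` from both sides and gives, for all `t` at once, a
difference of at most `b / v + v * |∂Q| / |Q|` between the distributions of `Q` and `graph n`
(`abs_spectralDistribution_sub_le`).

Bounded degree and self-similarity make `b / v` small for suitable `n`; with that `n` fixed, the
second term vanishes along every Følner sequence. So the distributions are uniformly Cauchy, with a
limit that does not depend on the sequence (`exists_forall_tendstoUniformly`). -/

/-! ### Counting eigenvalues of symmetric operators by quadratic forms -/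

section EigenvalueCount

variable {E : Type*} [NormedAddCommGroup E] [InnerProductSpace ℝ E]

/-- The vectors all of whose coordinates outside `S` vanish. -/
theorem exists_submodule_repr_eq_zero {n : ℕ} (b : OrthonormalBasis (Fin n) ℝ E)
    (S : Finset (Fin n)) :
    ∃ W : Submodule ℝ E, Module.finrank ℝ W = S.card ∧ ∀ x ∈ W, ∀ i ∉ S, b.repr x i = 0 := by
  refine ⟨Submodule.span ℝ (Set.range fun i : S => b i), ?_, ?_⟩
  · rw [finrank_span_eq_card]
    · simp
    · exact b.toBasis.linearIndependent.comp _ Subtype.val_injective |> fun h => by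
        simpa [Function.comp_def] using h
  · intro x hx i hi
    induction hx using Submodule.span_induction with
    | mem x h =>
      obtain ⟨j, rfl⟩ := h
      have : i ≠ j := fun h => hi (h ▸ j.2)
      simp [this]
    | zero => simp
    | add x y _ _ hx hy => simp [hx, hy]
    | smul a x _ hx => simp [hx]

variable [FiniteDimensional ℝ E]

open Classical in
/-- The number of eigenvalues of `T`, with multiplicity, that are at most `t`. -/
noncomputable def eigenvalueCount (T : E →ₗ[ℝ] E) (t : ℝ) : ℕ :=
  T.charpoly.roots.countP (fun μ => μ ≤ t)

open Classical in
theorem eigenvalueCount_eq_card {T : E →ₗ[ℝ] E} (hT : T.IsSymmetric) (t : ℝ) :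
    eigenvalueCount T t = (Finset.univ.filter fun i => hT.eigenvalues rfl i ≤ t).card := by
  rw [eigenvalueCount, hT.roots_charpoly_eq_eigenvalues rfl, Multiset.countP_map]
  rfl

theorem inner_apply_self_eq_sum {T : E →ₗ[ℝ] E} (hT : T.IsSymmetric) (x : E) :
    inner ℝ (T x) x =
      ∑ i, hT.eigenvalues rfl i * ((hT.eigenvectorBasis rfl).repr x i) ^ 2 := by
  rw [← (hT.eigenvectorBasis rfl).repr.inner_map_map, PiLp.inner_apply]
  refine Finset.sum_congr rfl fun i _ => ?_
  rw [hT.eigenvectorBasis_apply_self_apply rfl]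
  simp
  ring

theorem norm_sq_eq_sum_repr {T : E →ₗ[ℝ] E} (hT : T.IsSymmetric) (x : E) :
    ‖x‖ ^ 2 = ∑ i, ((hT.eigenvectorBasis rfl).repr x i) ^ 2 := by
  rw [← (hT.eigenvectorBasis rfl).repr.norm_map, EuclideanSpace.norm_sq_eq]
  simp

/-- The span of the eigenvectors with eigenvalue at most `t` works, since the form is diagonal in
the eigenbasis. -/
theorem exists_submodule_inner_le {T : E →ₗ[ℝ] E} (hT : T.IsSymmetric) (t : ℝ) :
    ∃ W : Submodule ℝ E, Module.finrank ℝ W = eigenvalueCount T t ∧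
      ∀ x ∈ W, inner ℝ (T x) x ≤ t * ‖x‖ ^ 2 := by
  classical
  obtain ⟨W, hW, h⟩ := exists_submodule_repr_eq_zero (hT.eigenvectorBasis rfl)
    (Finset.univ.filter fun i => hT.eigenvalues rfl i ≤ t)
  refine ⟨W, by rw [hW, eigenvalueCount_eq_card hT], fun x hx => ?_⟩
  rw [inner_apply_self_eq_sum hT, norm_sq_eq_sum_repr hT, Finset.mul_sum]
  refine Finset.sum_le_sum fun i _ => ?_
  by_cases hi : hT.eigenvalues rfl i ≤ t
  · exact mul_le_mul_of_nonneg_right hi (sq_nonneg _)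
  · rw [h x hx i (by simpa using hi)]
    simp

/-- The span of the remaining eigenvectors. It is the complementary witness that makes the count
extremal. -/
theorem exists_submodule_lt_inner {T : E →ₗ[ℝ] E} (hT : T.IsSymmetric) (t : ℝ) :
    ∃ W : Submodule ℝ E, Module.finrank ℝ W + eigenvalueCount T t = Module.finrank ℝ E ∧
      ∀ x ∈ W, x ≠ 0 → t * ‖x‖ ^ 2 < inner ℝ (T x) x := by
  classical
  obtain ⟨W, hW, h⟩ := exists_submodule_repr_eq_zero (hT.eigenvectorBasis rfl)
    (Finset.univ.filter fun i => ¬ hT.eigenvalues rfl i ≤ t)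
  refine ⟨W, ?_, fun x hx hx0 => ?_⟩
  · rw [hW, eigenvalueCount_eq_card hT, add_comm, Finset.card_filter_add_card_filter_not]
    simp
  · rw [inner_apply_self_eq_sum hT, norm_sq_eq_sum_repr hT, Finset.mul_sum]
    obtain ⟨j, hj⟩ : ∃ j, (hT.eigenvectorBasis rfl).repr x j ≠ 0 := by
      by_contra! h0
      exact hx0 ((hT.eigenvectorBasis rfl).repr.map_eq_zero_iff.1 (by ext i; simpa using h0 i))
    refine Finset.sum_lt_sum (fun i _ => ?_) ⟨j, Finset.mem_univ _, ?_⟩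
    · by_cases hi : hT.eigenvalues rfl i ≤ t
      · rw [h x hx i (by simpa using hi)]
        simp
      · exact mul_le_mul_of_nonneg_right (not_le.1 hi).le (sq_nonneg _)
    · have hj' : t < hT.eigenvalues rfl j := by
        by_contra hc
        exact hj (h x hx j (by simpa using hc))
      exact mul_lt_mul_of_pos_right hj' (by positivity)

theorem eigenvalueCount_le_finrank {T : E →ₗ[ℝ] E} (hT : T.IsSymmetric) (t : ℝ) :
    eigenvalueCount T t ≤ Module.finrank ℝ E := by
  obtain ⟨W, hW, -⟩ := exists_submodule_lt_inner hT t
  omega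

theorem finrank_add_finrank_le_of_forall_eq_zero {W W' : Submodule ℝ E}
    (h : ∀ x ∈ W, x ∈ W' → x = 0) :
    Module.finrank ℝ W + Module.finrank ℝ W' ≤ Module.finrank ℝ E :=
  Submodule.finrank_add_finrank_le_of_disjoint (Submodule.disjoint_def.2 h)

/-- Such a `W` meets the spectral subspace above `t` only in `0`, so the two dimensions add up to at
most that of `E`. -/
theorem finrank_le_eigenvalueCount {T : E →ₗ[ℝ] E} (hT : T.IsSymmetric) {t : ℝ}
    {W : Submodule ℝ E} (hW : ∀ x ∈ W, inner ℝ (T x) x ≤ t * ‖x‖ ^ 2) :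
    Module.finrank ℝ W ≤ eigenvalueCount T t := by
  obtain ⟨W', hW', h'⟩ := exists_submodule_lt_inner hT t
  have := finrank_add_finrank_le_of_forall_eq_zero (W := W) (W' := W') fun x hx hx' => by
    by_contra h0
    exact absurd (hW x hx) (not_le.2 (h' x hx' h0))
  omega

/-- The dual bound: here `W` meets the spectral subspace up to `t` only in `0`. -/
theorem finrank_add_eigenvalueCount_le {T : E →ₗ[ℝ] E} (hT : T.IsSymmetric) {t : ℝ}
    {W : Submodule ℝ E} (hW : ∀ x ∈ W, x ≠ 0 → t * ‖x‖ ^ 2 < inner ℝ (T x) x) :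
    Module.finrank ℝ W + eigenvalueCount T t ≤ Module.finrank ℝ E := by
  obtain ⟨W', hW', h'⟩ := exists_submodule_inner_le hT t
  have := finrank_add_finrank_le_of_forall_eq_zero (W := W) (W' := W') fun x hx hx' => by
    by_contra h0
    exact absurd (h' x hx') (not_le.2 (hW x hx h0))
  omega

end EigenvalueCount

/-! ### Transplanting subspaces along disjoint copies -/

/-- The vectors of `W` that vanish on `B` form a subspace of codimension at most `|B|` in `W`. -/
theorem exists_submodule_vanishing {α : Type*} [Fintype α] (W : Submodule ℝ (EuclideanSpace ℝ α))
    (B : Finset α) :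
    ∃ U ≤ W, (∀ f ∈ U, ∀ x ∈ B, f x = 0) ∧
      Module.finrank ℝ W ≤ Module.finrank ℝ U + B.card := by
  let L : W →ₗ[ℝ] (B → ℝ) :=
    { toFun := fun f x => (f : EuclideanSpace ℝ α) x
      map_add' := fun f g => by ext; simp
      map_smul' := fun c f => by ext; simp }
  refine ⟨(LinearMap.ker L).map W.subtype, Submodule.map_subtype_le _ _, ?_, ?_⟩
  · rintro f ⟨g, hg, rfl⟩ x hx
    exact congrFun (LinearMap.mem_ker.1 hg) ⟨x, hx⟩
  · rw [Submodule.finrank_map_subtype_eq, ← L.finrank_range_add_finrank_ker, add_comm]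
    gcongr
    simpa using (LinearMap.range L).finrank_le

section Transplant

variable {J α β : Type*}

/-- The linear map that places a family of functions on `α` on the copies of `α` in `β`. -/
noncomputable def transplant (e : J × α → β) :
    (J → EuclideanSpace ℝ α) →ₗ[ℝ] EuclideanSpace ℝ β where
  toFun g := WithLp.toLp 2 (Function.extend e (fun p => g p.1 p.2) 0)
  map_add' f g := by
    ext x
    by_cases hx : ∃ a, e a = x <;> simp [Function.extend, hx]
  map_smul' c g := by
    ext x
    by_cases hx : ∃ a, e a = x <;> simp [Function.extend, hx]

theorem transplant_apply {e : J × α → β} (he : Function.Injective e)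
    (g : J → EuclideanSpace ℝ α) (j : J) (a : α) : transplant e g (e (j, a)) = g j a :=
  he.extend_apply (fun p => g p.1 p.2) _ (j, a)

theorem transplant_apply_of_notMem {e : J × α → β} (g : J → EuclideanSpace ℝ α) {x : β}
    (hx : x ∉ Set.range e) : transplant e g x = 0 :=
  Function.extend_apply' (fun p : J × α => g p.1 p.2) (0 : β → ℝ) x hx

theorem transplant_injective {e : J × α → β} (he : Function.Injective e) :
    Function.Injective (transplant e) := by
  intro f g hfg
  ext j a
  rw [← transplant_apply he, hfg, transplant_apply he]

variable [Fintype J] [Fintype α]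

/-- The families with members in `U`, transplanted to `β`. -/
theorem exists_submodule_transplant {e : J × α → β} (he : Function.Injective e)
    (U : Submodule ℝ (EuclideanSpace ℝ α)) :
    ∃ W : Submodule ℝ (EuclideanSpace ℝ β),
      Module.finrank ℝ W = Fintype.card J * Module.finrank ℝ U ∧
      ∀ f ∈ W, ∃ g : J → EuclideanSpace ℝ α, (∀ j, g j ∈ U) ∧ transplant e g = f := by
  let L : (J → U) →ₗ[ℝ] EuclideanSpace ℝ β :=
    transplant e ∘ₗ LinearMap.compLeft U.subtype J
  refine ⟨LinearMap.range L, ?_, ?_⟩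
  · rw [LinearMap.finrank_range_of_inj, Module.finrank_pi_fintype]
    · simp
    · refine (transplant_injective he).comp fun f g hfg => ?_
      ext j : 2
      exact congrFun hfg j
  · rintro _ ⟨g, rfl⟩
    exact ⟨fun j => g j, fun j => (g j).2, rfl⟩

variable [Fintype β]

theorem sum_eq_sum_sum_of_injective {e : J × α → β} (he : Function.Injective e) {h : β → ℝ}
    (h0 : ∀ x ∉ Set.range e, h x = 0) : ∑ x, h x = ∑ j, ∑ a, h (e (j, a)) := by
  rw [← Fintype.sum_prod_type']
  symm
  exact Fintype.sum_of_injective e he _ _ h0 fun _ => rfl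

theorem norm_sq_transplant {e : J × α → β} (he : Function.Injective e)
    (g : J → EuclideanSpace ℝ α) : ‖transplant e g‖ ^ 2 = ∑ j, ‖g j‖ ^ 2 := by
  simp_rw [EuclideanSpace.norm_sq_eq]
  rw [sum_eq_sum_sum_of_injective he fun x hx => by simp [transplant_apply_of_notMem g hx]]
  simp_rw [transplant_apply he]

/-- If the kernels of `S` and `T` agree on the rows outside `B` along the copies of `α` in `β`,
then so do the quadratic forms on families of functions that vanish on `B`. -/
theorem inner_transplant {e : J × α → β} (he : Function.Injective e)
    {S : EuclideanSpace ℝ β →ₗ[ℝ] EuclideanSpace ℝ β} {K : β → β → ℝ}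
    (hS : ∀ f x, S f x = ∑ y, K x y * f y)
    {T : EuclideanSpace ℝ α →ₗ[ℝ] EuclideanSpace ℝ α} {M : α → α → ℝ}
    (hT : ∀ f x, T f x = ∑ y, M x y * f y) {B : Finset α}
    (hK : ∀ j, ∀ x ∉ B, ∀ y, K (e (j, x)) (e (j, y)) = M x y)
    (hK0 : ∀ j, ∀ x ∉ B, ∀ i y, i ≠ j → K (e (j, x)) (e (i, y)) = 0)
    {g : J → EuclideanSpace ℝ α} (hg : ∀ j, ∀ x ∈ B, g j x = 0) :
    inner ℝ (S (transplant e g)) (transplant e g) = ∑ j, inner ℝ (T (g j)) (g j) := by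
  simp_rw [PiLp.inner_apply]
  rw [sum_eq_sum_sum_of_injective he fun x hx => by simp [transplant_apply_of_notMem g hx]]
  refine Finset.sum_congr rfl fun j _ => Finset.sum_congr rfl fun x _ => ?_
  rw [transplant_apply he]
  -- A row in `B` is multiplied by `g j x = 0`, so nothing need be known about it; every other row
  -- sees only its own copy.
  by_cases hx : x ∈ B
  · simp [hg j x hx]
  · congr 1
    rw [hS, hT,
      sum_eq_sum_sum_of_injective he fun y hy => by simp [transplant_apply_of_notMem g hy],
      Finset.sum_eq_single j]
    · simp_rw [transplant_apply he, hK j x hx]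
    · intro i _ hij
      exact Finset.sum_eq_zero fun y _ => by rw [hK0 j x hx i y hij, zero_mul]
    · simp

/-- Copies of the spectral subspace of `T` up to `t`, cut down to functions vanishing on `B`, form a
test space for `S`. The loss `B.card` per copy stands on the right to avoid truncated subtraction.
-/
theorem card_mul_eigenvalueCount_sub_le {e : J × α → β} (he : Function.Injective e)
    {S : EuclideanSpace ℝ β →ₗ[ℝ] EuclideanSpace ℝ β} (hSs : S.IsSymmetric) {K : β → β → ℝ}
    (hS : ∀ f x, S f x = ∑ y, K x y * f y)
    {T : EuclideanSpace ℝ α →ₗ[ℝ] EuclideanSpace ℝ α} (hTs : T.IsSymmetric) {M : α → α → ℝ}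
    (hT : ∀ f x, T f x = ∑ y, M x y * f y) {B : Finset α}
    (hK : ∀ j, ∀ x ∉ B, ∀ y, K (e (j, x)) (e (j, y)) = M x y)
    (hK0 : ∀ j, ∀ x ∉ B, ∀ i y, i ≠ j → K (e (j, x)) (e (i, y)) = 0) (t : ℝ) :
    Fintype.card J * eigenvalueCount T t ≤ eigenvalueCount S t + Fintype.card J * B.card := by
  obtain ⟨W, hW, hWt⟩ := exists_submodule_inner_le hTs t
  obtain ⟨U, hUW, hU0, hU⟩ := exists_submodule_vanishing W B
  obtain ⟨X, hX, hXg⟩ := exists_submodule_transplant he U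
  have := finrank_le_eigenvalueCount hSs (t := t) (W := X) fun f hf => by
    obtain ⟨g, hg, rfl⟩ := hXg f hf
    rw [inner_transplant he hS hT hK hK0 fun j => hU0 _ (hg j), norm_sq_transplant he,
      Finset.mul_sum]
    exact Finset.sum_le_sum fun j _ => hWt _ (hUW (hg j))
  rw [hX] at this
  rw [← hW]
  nlinarith [Nat.mul_le_mul_left (Fintype.card J) hU]

/-- The same construction with the spectral subspace above `t` bounds the count for `S` from above.
-/
theorem card_mul_sub_eigenvalueCount_le {e : J × α → β} (he : Function.Injective e)
    {S : EuclideanSpace ℝ β →ₗ[ℝ] EuclideanSpace ℝ β} (hSs : S.IsSymmetric) {K : β → β → ℝ}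
    (hS : ∀ f x, S f x = ∑ y, K x y * f y)
    {T : EuclideanSpace ℝ α →ₗ[ℝ] EuclideanSpace ℝ α} (hTs : T.IsSymmetric) {M : α → α → ℝ}
    (hT : ∀ f x, T f x = ∑ y, M x y * f y) {B : Finset α}
    (hK : ∀ j, ∀ x ∉ B, ∀ y, K (e (j, x)) (e (j, y)) = M x y)
    (hK0 : ∀ j, ∀ x ∉ B, ∀ i y, i ≠ j → K (e (j, x)) (e (i, y)) = 0) (t : ℝ) :
    Fintype.card J * Fintype.card α + eigenvalueCount S t ≤
      Fintype.card β + Fintype.card J * eigenvalueCount T t + Fintype.card J * B.card := by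
  obtain ⟨W, hW, hWt⟩ := exists_submodule_lt_inner hTs t
  obtain ⟨U, hUW, hU0, hU⟩ := exists_submodule_vanishing W B
  obtain ⟨X, hX, hXg⟩ := exists_submodule_transplant he U
  have := finrank_add_eigenvalueCount_le hSs (t := t) (W := X) fun f hf hf0 => by
    obtain ⟨g, hg, rfl⟩ := hXg f hf
    rw [inner_transplant he hS hT hK hK0 fun j => hU0 _ (hg j), norm_sq_transplant he,
      Finset.mul_sum]
    -- The strict bound fails for zero components, which give equality; one nonzero component makes
    -- the sum strict.
    obtain ⟨i, hi⟩ : ∃ i, g i ≠ 0 := by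
      by_contra! h
      exact hf0 (by rw [show g = 0 from funext h, map_zero])
    refine Finset.sum_lt_sum (fun j _ => ?_) ⟨i, Finset.mem_univ _, hWt _ (hUW (hg i)) hi⟩
    by_cases hj : g j = 0
    · simp [hj]
    · exact (hWt _ (hUW (hg j)) hj).le
  rw [hX, finrank_euclideanSpace] at this
  rw [finrank_euclideanSpace] at hW
  rw [← hW]
  nlinarith [Nat.mul_le_mul_left (Fintype.card J) hU]

end Transplant

/-! ### The tiling of a self-similar graph -/

namespace SelfSimilarPresentation

variable {V : Type*} {G : SimpleGraph V} {d k : ℕ} (P : SelfSimilarPresentation G d k)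

theorem verts_subset_succ (n : ℕ) : (P.graph n).verts ⊆ (P.graph (n + 1)).verts := by
  intro x hx
  have := (P.copy n (⟨0, P.k_pos⟩, ⟨x, hx⟩)).2
  rwa [P.copy_first] at this

theorem graph_mono : Monotone P.graph := by
  refine monotone_nat_of_le_succ fun n => ⟨P.verts_subset_succ n, fun x y h => ?_⟩
  have := P.adj_copy n ⟨0, P.k_pos⟩ ⟨x, h.fst_mem⟩ ⟨y, h.snd_mem⟩ h
  rwa [P.copy_first, P.copy_first] at this

theorem exists_mem_verts (x : V) : ∃ n, x ∈ (P.graph n).verts := by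
  have : x ∈ (⨆ n, P.graph n).verts := by rw [P.iSup_eq_top]; trivial
  simpa using this

theorem exists_adj {x y : V} (h : G.Adj x y) : ∃ n, (P.graph n).Adj x y := by
  have : (⨆ n, P.graph n).Adj x y := by rw [P.iSup_eq_top]; exact h
  simpa using this

theorem finite_verts (n : ℕ) : (P.graph n).verts.Finite := by
  induction n with
  | zero => exact P.finite_zero
  | succ n ih =>
    have : Finite (P.graph n).verts := ih
    exact Set.finite_coe_iff.1 (Finite.of_equiv _ (P.copy n))

theorem nonempty_verts (n : ℕ) : (P.graph n).verts.Nonempty :=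
  (P.connected n).nonempty

theorem exists_finset_subset_verts (Q : Finset V) : ∃ m, (Q : Set V) ⊆ (P.graph m).verts := by
  have hdir : Directed (· ⊆ ·) fun n => (P.graph n).verts :=
    (monotone_nat_of_le_succ P.verts_subset_succ).directed_le
  exact hdir.exists_mem_subset_of_finset_subset_biUnion fun x _ => by
    simpa using P.exists_mem_verts x

/-- An edge of `graph (n + 1)` at a vertex of `graph n` is an edge of `graph n` unless the vertex is
a connecting vertex. -/
theorem adj_of_adj_succ {n : ℕ} {x y : V} (hx : x ∈ (P.graph n).verts)
    (h : (P.graph (n + 1)).Adj x y) : (P.graph n).Adj x y ∨ x ∈ P.conn n := by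
  obtain ⟨⟨i, w⟩, hw⟩ := (P.copy n).surjective ⟨y, h.snd_mem⟩
  have hy : y = P.copy n (i, w) := by rw [hw]
  have hx' : x = P.copy n (⟨0, P.k_pos⟩, ⟨x, hx⟩) := (P.copy_first n ⟨x, hx⟩).symm
  have h' := h
  rw [hx', hy] at h'
  rcases P.adj_new n _ _ _ _ h' with ⟨hi, ha⟩ | ⟨ha, -⟩
  · left
    rwa [hy, ← hi, P.copy_first]
  · exact Or.inr ha

/-- The neighbourhood in `G` of a vertex of `graph n` is determined by `graph (n + 1)`. -/
theorem adj_succ_of_adj {n : ℕ} {x y : V} (hx : x ∈ (P.graph n).verts) (h : G.Adj x y) :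
    (P.graph (n + 1)).Adj x y := by
  obtain ⟨N, hN⟩ := P.exists_adj h
  have hN' : (P.graph (n + 1 + N)).Adj x y := (P.graph_mono (by omega : N ≤ n + 1 + N)).2 hN
  clear hN
  induction N with
  | zero => exact hN'
  | succ N ih =>
    -- Descend one stage: the edge could only be new if `x` were connecting at stage `n + 1 + N`,
    -- but those vertices avoid `graph (n + N)`, which contains `graph n`.
    refine ih ((P.adj_of_adj_succ ?_ hN').resolve_right fun hc => ?_)
    · exact (P.graph_mono (by omega : n ≤ n + 1 + N)).1 hx
    · change x ∈ P.conn (n + 1 + N) at hc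
      rw [show n + 1 + N = n + N + 1 by omega] at hc
      exact Set.disjoint_left.1 (P.conn_succ_disjoint (n + N)) hc
        ((P.graph_mono (by omega : n ≤ n + N)).1 hx)

theorem adj_of_adj {n : ℕ} {x y : V} (hx : x ∈ (P.graph n).verts) (h : G.Adj x y) :
    (P.graph n).Adj x y ∨ x ∈ P.conn n :=
  P.adj_of_adj_succ hx (P.adj_succ_of_adj hx h)

/-- `graph (n + j)` is tiled by copies of `graph n`. -/
theorem exists_tiling (n j : ℕ) :
    ∃ (ι : Type) (_ : Finite ι) (e : ι × (P.graph n).verts ≃ (P.graph (n + j)).verts),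
      (∀ i (x y : (P.graph n).verts), (P.graph n).Adj x y →
        (P.graph (n + j)).Adj (e (i, x)) (e (i, y))) ∧
      (∀ i i' (x y : (P.graph n).verts), (P.graph (n + j)).Adj (e (i, x)) (e (i', y)) →
        (i = i' ∧ (P.graph n).Adj x y) ∨ ((x : V) ∈ P.conn n ∧ (y : V) ∈ P.conn n)) ∧
      ∀ i x, (e (i, x) : V) ∈ P.conn (n + j) → (x : V) ∈ P.conn n := by
  induction j with
  | zero =>
    exact ⟨Unit, inferInstance, Equiv.punitProd _, fun _ _ _ h => h, fun _ _ _ _ h => .inl ⟨rfl, h⟩,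
      fun _ _ h => h⟩
  | succ j ih =>
    obtain ⟨ι, hι, e, h1, h2, h3⟩ := ih
    refine ⟨Fin k × ι, inferInstance, (Equiv.prodAssoc _ _ _).trans
      (((Equiv.refl _).prodCongr e).trans (P.copy (n + j))), ?_, ?_, ?_⟩
    · exact fun i x y h => P.adj_copy _ _ _ _ (h1 _ _ _ h)
    · intro i i' x y h
      rcases P.adj_new _ _ _ _ _ h with ⟨hi, h⟩ | ⟨hx, hy⟩
      · rcases h2 _ _ _ _ h with ⟨hi', h⟩ | h
        · exact .inl ⟨Prod.ext hi hi', h⟩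
        · exact .inr h
      · exact .inr ⟨h3 _ _ hx, h3 _ _ hy⟩
    · intro i x h
      obtain ⟨a, w, hw, h⟩ := P.conn_succ_subset _ _ h
      have := (P.copy (n + j)).injective (Subtype.ext h)
      have hw' : e (i.2, x) = w := (Prod.ext_iff.1 this).2
      rw [← hw'] at hw
      exact h3 _ _ hw

/-- A copy of `graph n` in `G` that is joined to the rest of `G` through connecting vertices. -/
structure IsTile (n : ℕ) (φ : (P.graph n).verts → V) : Prop where
  injective : Function.Injective φ
  adj : ∀ x y : (P.graph n).verts, (P.graph n).Adj x y → G.Adj (φ x) (φ y)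
  exists_adj : ∀ (x : (P.graph n).verts) (v : V), (x : V) ∉ P.conn n → G.Adj (φ x) v →
    ∃ y, φ y = v ∧ (P.graph n).Adj x y

theorem isTile_val (n : ℕ) : P.IsTile n Subtype.val where
  injective := Subtype.val_injective
  adj _ _ h := h.adj_sub
  exists_adj x v hx h := by
    have h' := (P.adj_of_adj x.2 h).resolve_right hx
    exact ⟨⟨v, h'.snd_mem⟩, rfl, h'⟩

/-- Every finite set of vertices is covered by finitely many disjoint tiles. -/
theorem exists_tiles (n : ℕ) (Q : Finset V) :
    ∃ (ι : Type) (_ : Finite ι) (e : ι × (P.graph n).verts → V), Function.Injective e ∧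
      (∀ i, P.IsTile n fun x => e (i, x)) ∧ (Q : Set V) ⊆ Set.range e := by
  obtain ⟨m, hm⟩ := P.exists_finset_subset_verts Q
  -- The stage `n + m` is used because it is tiled by copies of `graph n` and also contains `graph
  -- m`, hence `Q`.
  obtain ⟨ι, hι, e, h1, h2, h3⟩ := P.exists_tiling n m
  have hinj : Function.Injective fun p => (e p : V) := Subtype.val_injective.comp e.injective
  refine ⟨ι, hι, fun p => e p, hinj, fun i => ⟨fun x y h => ?_, ?_, ?_⟩, fun x hx => ?_⟩
  · exact (Prod.ext_iff.1 (hinj h)).2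
  · exact fun x y h => (h1 i x y h).adj_sub
  · intro x v hx h
    -- A connecting vertex of the large graph is connecting in its tile, so no edge of `G` at `e (i,
    -- x)` is added after stage `n + m`.
    have h' := (P.adj_of_adj (e (i, x)).2 h).resolve_right fun hc => hx (h3 _ _ hc)
    obtain ⟨⟨i', y⟩, hy⟩ := e.surjective ⟨v, h'.snd_mem⟩
    have hv : v = e (i', y) := by rw [hy]
    rw [hv] at h'
    obtain ⟨rfl, ha⟩ := (h2 _ _ _ _ h').resolve_right fun hc => hx hc.1
    exact ⟨y, hv.symm, ha⟩
  · have hx' := (P.graph_mono (by omega : m ≤ n + m)).1 (hm hx)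
    exact ⟨e.symm ⟨x, hx'⟩, by simp⟩

/-! ### Vertices far from the connecting vertices -/

/-- The vertices of `graph n` at distance at most `r` from the connecting vertices. -/
def nearConn (n : ℕ) : ℕ → Set V
  | 0 => P.conn n
  | r + 1 => nearConn n r ∪ ⋃ y ∈ nearConn n r, (P.graph n).neighborSet y

theorem nearConn_subset_verts (n r : ℕ) : P.nearConn n r ⊆ (P.graph n).verts := by
  induction r with
  | zero => exact P.conn_subset n
  | succ r ih =>
    refine Set.union_subset ih (Set.iUnion₂_subset fun y _ x hx => ?_)
    exact SimpleGraph.Subgraph.Adj.snd_mem hx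

theorem finite_nearConn (n r : ℕ) : (P.nearConn n r).Finite :=
  (P.finite_verts n).subset (P.nearConn_subset_verts n r)

theorem nearConn_mono (n : ℕ) : Monotone (P.nearConn n) :=
  monotone_nat_of_le_succ fun _ => Set.subset_union_left

theorem notMem_nearConn_of_adj {n r : ℕ} {x y : V} (hx : x ∉ P.nearConn n (r + 1))
    (h : (P.graph n).Adj x y) : y ∉ P.nearConn n r :=
  fun hy => hx (Or.inr (Set.mem_biUnion hy h.symm))

/-- Each enlargement keeps every vertex and adds at most `d` neighbours of it, a factor `d + 1`. -/
theorem ncard_nearConn_le (n r : ℕ) :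
    (P.nearConn n r).ncard ≤ (P.conn n).ncard * (d + 1) ^ r := by
  induction r with
  | zero => simp [nearConn]
  | succ r ih =>
    have hdeg : ∀ y ∈ (P.finite_nearConn n r).toFinset,
        ((P.graph n).neighborSet y).ncard ≤ d := fun y hy => by
      have := P.degree_le n y (P.nearConn_subset_verts n r (by simpa using hy))
      exact ENat.toNat_le_of_le_natCast this
    calc (P.nearConn n (r + 1)).ncard
        ≤ (P.nearConn n r).ncard +
          (⋃ y ∈ (P.finite_nearConn n r).toFinset, (P.graph n).neighborSet y).ncard := by
          simpa [nearConn] using Set.ncard_union_le (P.nearConn n r)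
            (⋃ y ∈ P.nearConn n r, (P.graph n).neighborSet y)
      _ ≤ (P.nearConn n r).ncard + (P.nearConn n r).ncard * d := by
          gcongr
          refine (Finset.set_ncard_biUnion_le _ _).trans ((Finset.sum_le_card_nsmul _ _ _ hdeg).trans ?_)
          rw [smul_eq_mul, Set.ncard_eq_toFinset_card _ (P.finite_nearConn n r)]
      _ = (P.nearConn n r).ncard * (d + 1) := by ring
      _ ≤ (P.conn n).ncard * (d + 1) ^ r * (d + 1) := by gcongr
      _ = _ := by ring

section Tile

variable {P} {n : ℕ} {φ : (P.graph n).verts → V}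

theorem IsTile.adj_iff (hφ : P.IsTile n φ) {x : (P.graph n).verts} (hx : (x : V) ∉ P.conn n)
    (y : (P.graph n).verts) : G.Adj (φ x) (φ y) ↔ (P.graph n).Adj x y := by
  refine ⟨fun h => ?_, hφ.adj x y⟩
  obtain ⟨z, hz, h⟩ := hφ.exists_adj x _ hx h
  rwa [← hφ.injective hz]

/-- The ball of radius `r` around `x` in `graph n`, which every tile map sends onto a ball of `G`
if `x` is far from the connecting vertices. -/
def tileBall (P : SelfSimilarPresentation G d k) {n : ℕ} (x : (P.graph n).verts) (r : ℕ) :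
    Set (P.graph n).verts :=
  {y | ∃ w : (P.graph n).coe.Walk x y, w.length ≤ r}

theorem mem_tileBall_self (P : SelfSimilarPresentation G d k) {n : ℕ} (x : (P.graph n).verts)
    (r : ℕ) : x ∈ P.tileBall x r :=
  ⟨.nil, by simp⟩

theorem notMem_conn_of_mem_tileBall {r : ℕ} {x y : (P.graph n).verts}
    (hx : (x : V) ∉ P.nearConn n r) (hy : y ∈ P.tileBall x r) : (y : V) ∉ P.conn n := by
  obtain ⟨w, hw⟩ := hy
  induction w generalizing r with
  | nil => exact fun h => hx (P.nearConn_mono n (Nat.zero_le r) h)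
  | cons h w ih =>
    rw [SimpleGraph.Walk.length_cons] at hw
    obtain ⟨r, rfl⟩ : ∃ s, r = s + 1 := ⟨r - 1, by omega⟩
    exact ih (P.notMem_nearConn_of_adj hx h) (by omega)

/-- A walk can leave the tile only from a connecting vertex. Each step uses up one unit of the
distance to those vertices, so `r` steps lift to `graph n`. -/
theorem IsTile.exists_mem_tileBall (hφ : P.IsTile n φ) {r : ℕ} {x : (P.graph n).verts}
    (hx : (x : V) ∉ P.nearConn n r) {u v : V} (hu : φ x = u) (w : G.Walk u v) (hw : w.length ≤ r) :
    ∃ y ∈ P.tileBall x r, φ y = v := by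
  induction w generalizing r x with
  | nil => exact ⟨x, P.mem_tileBall_self x r, hu⟩
  | cons h w ih =>
    rw [SimpleGraph.Walk.length_cons] at hw
    obtain ⟨r, rfl⟩ : ∃ s, r = s + 1 := ⟨r - 1, by omega⟩
    rw [← hu] at h
    obtain ⟨z, hz, hxz⟩ := hφ.exists_adj x _ (fun hc => hx (P.nearConn_mono n (Nat.zero_le _) hc)) h
    obtain ⟨y, ⟨w', hw'⟩, hy⟩ := ih (P.notMem_nearConn_of_adj hx hxz) hz (by omega)
    exact ⟨y, ⟨.cons (show (P.graph n).coe.Adj x z from hxz) w', by simpa using hw'⟩, hy⟩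

theorem IsTile.mem_graphBall (hφ : P.IsTile n φ) {r : ℕ} {x y : (P.graph n).verts}
    (hy : y ∈ P.tileBall x r) : φ y ∈ graphBall G (φ x) r := by
  obtain ⟨w, hw⟩ := hy
  let f : (P.graph n).coe →g G := ⟨φ, fun {a b} h => hφ.adj a b h⟩
  refine (SimpleGraph.edist_le (w.map f)).trans ?_
  rw [SimpleGraph.Walk.length_map]
  exact_mod_cast hw

theorem IsTile.exists_of_mem_graphBall (hφ : P.IsTile n φ) {r : ℕ} {x : (P.graph n).verts}
    (hx : (x : V) ∉ P.nearConn n r) {v : V} (hv : v ∈ graphBall G (φ x) r) :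
    ∃ y ∈ P.tileBall x r, φ y = v := by
  have hv : G.edist (φ x) v ≤ r := hv
  have hr : G.Reachable (φ x) v :=
    SimpleGraph.reachable_of_edist_ne_top fun h => by simp [h] at hv
  obtain ⟨w, hw⟩ := hr.exists_walk_length_eq_edist
  rw [← hw] at hv
  exact hφ.exists_mem_tileBall hx rfl w (by exact_mod_cast hv)

/-- A tile map induces an isomorphism from the ball in `graph n` to the ball in `G`. -/
noncomputable def IsTile.ballIso (hφ : P.IsTile n φ) {r : ℕ} {x : (P.graph n).verts}
    (hx : (x : V) ∉ P.nearConn n r) :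
    (P.graph n).coe.induce (P.tileBall x r) ≃g G.induce (graphBall G (φ x) r) where
  toEquiv := Equiv.ofBijective (fun y => ⟨φ y, hφ.mem_graphBall y.2⟩) <| by
    refine ⟨fun y z h => Subtype.ext (hφ.injective (Subtype.ext_iff.1 h)), fun v => ?_⟩
    obtain ⟨y, hy, h⟩ := hφ.exists_of_mem_graphBall hx v.2
    exact ⟨⟨y, hy⟩, Subtype.ext h⟩
  -- Even vertices at distance exactly `r` are not connecting, so no extra edges of `G` appear
  -- within the ball.
  map_rel_iff' {y z} := hφ.adj_iff (notMem_conn_of_mem_tileBall hx y.2) z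

/-- A pattern-invariant kernel takes the same values on all tiles. -/
theorem IsTile.kernel_eq (hφ : P.IsTile n φ) {r : ℕ} {A : V → V → ℝ}
    (hA0 : ∀ x y, (r : ℕ∞) < G.edist x y → A x y = 0)
    (hA : ∀ (x x' : V) (ψ : G.induce (graphBall G x r) ≃g G.induce (graphBall G x' r)),
      ψ ⟨x, mem_graphBall_self G x r⟩ = ⟨x', mem_graphBall_self G x' r⟩ →
      ∀ y : graphBall G x r, A x y = A x' (ψ y))
    {x : (P.graph n).verts} (hx : (x : V) ∉ P.nearConn n r) (y : (P.graph n).verts) :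
    A (φ x) (φ y) = A x y := by
  have hval := P.isTile_val n
  by_cases hy : y ∈ P.tileBall x r
  · have key : ∀ z : P.tileBall x r,
        ((hval.ballIso hx).symm.trans (hφ.ballIso hx)) (hval.ballIso hx z) = hφ.ballIso hx z :=
      fun z => by simp
    -- Both `graph n` itself and its image under `φ` are tiles; going back through the first and out
    -- through the second is a rooted isomorphism of balls in `G`.
    have := hA x (φ x) ((hval.ballIso hx).symm.trans (hφ.ballIso hx))
      (key ⟨x, P.mem_tileBall_self x r⟩) (hval.ballIso hx ⟨y, hy⟩)
    rw [key] at this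
    exact this.symm
  · rw [hA0, hA0]
    · by_contra! h
      obtain ⟨z, hz, hzy⟩ := hval.exists_of_mem_graphBall hx h
      exact hy (Subtype.ext hzy ▸ hz)
    · by_contra! h
      obtain ⟨z, hz, hzy⟩ := hφ.exists_of_mem_graphBall hx h
      exact hy (hφ.injective hzy ▸ hz)

theorem IsTile.kernel_eq_zero (hφ : P.IsTile n φ) {r : ℕ} {A : V → V → ℝ}
    (hA0 : ∀ x y, (r : ℕ∞) < G.edist x y → A x y = 0)
    {x : (P.graph n).verts} (hx : (x : V) ∉ P.nearConn n r) {v : V} (hv : v ∉ Set.range φ) :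
    A (φ x) v = 0 := by
  refine hA0 _ _ ?_
  by_contra! h
  obtain ⟨z, -, hz⟩ := hφ.exists_of_mem_graphBall hx h
  exact hv ⟨z, hz⟩

/-- A tile that meets `Q` but is not contained in `Q` meets the boundary of `Q`. -/
theorem IsTile.exists_mem_innerBoundary (hφ : P.IsTile n φ) {Q : Finset V}
    {x y : (P.graph n).verts} (hx : φ x ∈ Q) (hy : φ y ∉ Q) : ∃ z, φ z ∈ innerBoundary G Q := by
  obtain ⟨w⟩ := (P.connected n).coe.preconnected x y
  induction w with
  | nil => exact absurd hx hy
  | @cons u v _ h w ih =>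
    by_cases hv : φ v ∈ Q
    · exact ih hv hy
    · exact ⟨u, hx, φ v, hv, hφ.adj _ _ h⟩

end Tile

end SelfSimilarPresentation

/-! ### Truncated operators -/

section Truncation

variable {V : Type*}

theorem extendByZero_apply_of_mem {Q : Finset V} (f : EuclideanSpace ℝ Q) {x : V} (hx : x ∈ Q) :
    extendByZero Q f x = f ⟨x, hx⟩ :=
  dif_pos hx

theorem extendByZero_apply_of_notMem {Q : Finset V} (f : EuclideanSpace ℝ Q) {x : V}
    (hx : x ∉ Q) : extendByZero Q f x = 0 :=
  dif_neg hx

theorem truncation_apply {T : lp (fun _ : V => ℝ) 2 →L[ℝ] lp (fun _ : V => ℝ) 2} {A : V → V → ℝ}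
    (hA : ∀ (f : lp (fun _ : V => ℝ) 2) (x : V), T f x = ∑' y, A x y * f y) (Q : Finset V)
    (f : EuclideanSpace ℝ Q) (x : Q) : truncation T Q f x = ∑ y : Q, A x y * f y := by
  change T (extendByZero Q f) x = _
  rw [hA, tsum_eq_sum (s := Q) fun y hy => by rw [extendByZero_apply_of_notMem f hy, mul_zero],
    ← Finset.sum_coe_sort]
  exact Finset.sum_congr rfl fun y _ => by rw [extendByZero_apply_of_mem f y.2]

theorem inner_restrictTo (Q : Finset V) (f : lp (fun _ : V => ℝ) 2) (g : EuclideanSpace ℝ Q) :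
    inner ℝ (restrictTo Q f) g = inner ℝ f (extendByZero Q g) := by
  rw [lp.inner_eq_tsum, PiLp.inner_apply,
    tsum_eq_sum (s := Q) fun y hy => by rw [extendByZero_apply_of_notMem g hy, inner_zero_right],
    ← Finset.sum_coe_sort Q]
  exact Finset.sum_congr rfl fun y _ => by rw [extendByZero_apply_of_mem g y.2]; rfl

/-- Restriction is the adjoint of extension by zero, so the truncation is a compression of `T`. -/
theorem isSymmetric_truncation {T : lp (fun _ : V => ℝ) 2 →L[ℝ] lp (fun _ : V => ℝ) 2}
    (hT : IsSelfAdjoint T) (Q : Finset V) : (truncation T Q).IsSymmetric := by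
  intro f g
  have h := hT.isSymmetric (extendByZero Q f) (extendByZero Q g)
  change inner ℝ (restrictTo Q (T (extendByZero Q f))) g =
    inner ℝ f (restrictTo Q (T (extendByZero Q g)))
  rw [inner_restrictTo, real_inner_comm (restrictTo Q _) f, inner_restrictTo,
    real_inner_comm (extendByZero Q f)]
  exact h

end Truncation

/-! ### Comparison with a single tile -/

/-- The arithmetic of the comparison: `q` and `c'` are size and eigenvalue count for `Q`, `v` and
`c` those for `graph n`, `j` is the number of tiles inside `Q`, `b` the number of bad vertices per
tile, and `p` the size of `∂Q`. -/
theorem abs_div_sub_div_le {q v c c' j b p : ℕ} (hq : 0 < q) (hv : 0 < v) (hc : c ≤ v)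
    (h1 : j * c ≤ c' + j * b) (h2 : j * v + c' ≤ q + j * c + j * b) (h3 : q ≤ j * v + p * v)
    (h4 : j * v ≤ q) : |(c' : ℝ) / q - c / v| ≤ b / v + v * (p / q) := by
  have hq' : (0 : ℝ) < q := by exact_mod_cast hq
  have hv' : (0 : ℝ) < v := by exact_mod_cast hv
  have e1 : (c' : ℝ) / q - c / v = (c' * v - c * q) / (q * v) := by field_simp
  have e2 : (b : ℝ) / v + v * (p / q) = (b * q + p * v * v) / (q * v) := by field_simp
  rw [e1, e2, abs_div, abs_of_pos (mul_pos hq' hv')]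
  gcongr
  have h4c : c * (j * v) ≤ c * q := by gcongr
  have h4b : b * (j * v) ≤ b * q := by gcongr
  have k1 : c' * v ≤ c * q + (b * q + p * v * v) := by
    have : (j * v + c') * v ≤ (j * v + p * v + j * c + j * b) * v := by
      exact Nat.mul_le_mul_right v (by omega)
    nlinarith
  have k2 : c * q ≤ c' * v + (b * q + p * v * v) := by
    have a1 : c * q ≤ c * (j * v + p * v) := by gcongr
    have a2 : (j * c) * v ≤ (c' + j * b) * v := by gcongr
    have a3 : c * (p * v) ≤ v * (p * v) := by gcongr
    nlinarith
  rw [abs_le]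
  constructor
  · have : (c * q : ℝ) ≤ c' * v + (b * q + p * v * v) := by exact_mod_cast k2
    linarith
  · have : (c' * v : ℝ) ≤ c * q + (b * q + p * v * v) := by exact_mod_cast k1
    linarith

theorem innerBoundary_subset {V : Type*} (G : SimpleGraph V) (Q : Finset V) :
    innerBoundary G Q ⊆ Q :=
  fun _ h => h.1

namespace SelfSimilarPresentation

variable {V : Type*} {G : SimpleGraph V} {d k : ℕ} (P : SelfSimilarPresentation G d k)

/-- Tiles are disjoint, so those meeting `Q` without lying in it number at most `|∂Q|`, each
containing a boundary vertex of its own. -/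
theorem card_le_of_tiles {n : ℕ} {Q : Finset V} {ι : Type} [Finite ι]
    {e : ι × (P.graph n).verts → V} (he : Function.Injective e)
    (ht : ∀ i, P.IsTile n fun x => e (i, x)) (hQ : (Q : Set V) ⊆ Set.range e) :
    Q.card ≤ Nat.card {i // ∀ x, e (i, x) ∈ Q} * (P.graph n).verts.ncard +
      (innerBoundary G Q).ncard * (P.graph n).verts.ncard := by
  have : Finite (P.graph n).verts := P.finite_verts n
  let I : Set ι := {i | ∀ x, e (i, x) ∈ Q}
  let I' : Set ι := Prod.fst '' (e ⁻¹' innerBoundary G Q)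
  have hsub : (Q : Set V) ⊆ e '' (I ×ˢ Set.univ) ∪ e '' (I' ×ˢ Set.univ) := by
    intro x hx
    obtain ⟨⟨i, y⟩, rfl⟩ := hQ hx
    by_cases hi : i ∈ I
    · exact .inl ⟨(i, y), ⟨hi, trivial⟩, rfl⟩
    · obtain ⟨z, hz⟩ : ∃ z, e (i, z) ∉ Q := by simpa [I] using hi
      obtain ⟨w, hw⟩ := (ht i).exists_mem_innerBoundary hx hz
      exact .inr ⟨(i, y), ⟨⟨(i, w), hw, rfl⟩, trivial⟩, rfl⟩
  have hI' : I'.ncard ≤ (innerBoundary G Q).ncard :=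
    (Set.ncard_image_le (Set.toFinite _)).trans_eq <|
      Set.ncard_preimage_of_injective_subset_range he ((innerBoundary_subset G Q).trans hQ)
  calc Q.card = (Q : Set V).ncard := (Set.ncard_coe_finset Q).symm
    _ ≤ (e '' (I ×ˢ Set.univ) ∪ e '' (I' ×ˢ Set.univ)).ncard :=
        Set.ncard_le_ncard hsub (Set.toFinite _)
    _ ≤ (e '' (I ×ˢ Set.univ)).ncard + (e '' (I' ×ˢ Set.univ)).ncard := Set.ncard_union_le _ _
    _ = I.ncard * (P.graph n).verts.ncard + I'.ncard * (P.graph n).verts.ncard := by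
        simp_rw [Set.ncard_image_of_injective _ he, Set.ncard_prod, Set.ncard_univ,
          Nat.card_coe_set_eq]
    _ ≤ _ := by
        gcongr
        exact le_of_eq (Nat.card_coe_set_eq I).symm

/-- The spectral distribution of a truncation to `Q` is close to that of a truncation to `graph n`
if `Q` has a small boundary and `graph n` has few vertices near its connecting vertices. -/
theorem abs_spectralDistribution_sub_le
    {T : lp (fun _ : V => ℝ) 2 →L[ℝ] lp (fun _ : V => ℝ) 2} (hT : IsSelfAdjoint T)
    {r : ℕ} {A : V → V → ℝ}
    (hTA : ∀ (f : lp (fun _ : V => ℝ) 2) (x : V), T f x = ∑' y, A x y * f y)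
    (hA0 : ∀ x y, (r : ℕ∞) < G.edist x y → A x y = 0)
    (hA : ∀ (x x' : V) (ψ : G.induce (graphBall G x r) ≃g G.induce (graphBall G x' r)),
      ψ ⟨x, mem_graphBall_self G x r⟩ = ⟨x', mem_graphBall_self G x' r⟩ →
      ∀ y : graphBall G x r, A x y = A x' (ψ y))
    (n : ℕ) {Q : Finset V} (hQ : Q.Nonempty) (t : ℝ) :
    |spectralDistribution (truncation T Q) t -
        spectralDistribution (truncation T (P.finite_verts n).toFinset) t| ≤
      (P.nearConn n r).ncard / (P.graph n).verts.ncard +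
        (P.graph n).verts.ncard * ((innerBoundary G Q).ncard / Q.card) := by
  classical
  obtain ⟨ι, _, e, he, ht, hQe⟩ := P.exists_tiles n Q
  set F := (P.finite_verts n).toFinset
  have hFcard : (P.graph n).verts.ncard = F.card := Set.ncard_eq_toFinset_card _ _
  have hFmem : ∀ x : F, (x : V) ∈ (P.graph n).verts := fun x =>
    (P.finite_verts n).mem_toFinset.1 x.2
  have : Fintype {i // ∀ x, e (i, x) ∈ Q} := Fintype.ofFinite _
  -- Only tiles lying entirely in `Q` are used for transplanting.
  let e' : {i // ∀ x, e (i, x) ∈ Q} × F → Q := fun p => ⟨e (p.1, ⟨p.2, hFmem p.2⟩), p.1.2 _⟩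
  have he' : Function.Injective e' := by
    rintro ⟨i, x⟩ ⟨j, y⟩ h
    have h' := he (Subtype.ext_iff.1 h)
    simp only [Prod.mk.injEq, Subtype.mk.injEq] at h'
    exact Prod.ext (Subtype.ext h'.1) (Subtype.ext h'.2)
  let B : Finset F := Finset.univ.filter fun x => (x : V) ∈ P.nearConn n r
  have hB : B.card ≤ (P.nearConn n r).ncard := by
    rw [Set.ncard_eq_toFinset_card _ (P.finite_nearConn n r)]
    exact Finset.card_le_card_of_injOn Subtype.val (fun x hx => by simpa [B] using hx)
      Subtype.val_injective.injOn
  have hK : ∀ j, ∀ x ∉ B, ∀ y, A (e' (j, x)) (e' (j, y)) = A x y := fun j x hx y =>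
    (ht j).kernel_eq hA0 hA (x := ⟨x, hFmem x⟩) (by simpa [B] using hx) ⟨y, hFmem y⟩
  have hK0 : ∀ j, ∀ x ∉ B, ∀ i y, i ≠ j → A (e' (j, x)) (e' (i, y)) = 0 :=
    fun j x hx i y hij => (ht j).kernel_eq_zero hA0 (x := ⟨x, hFmem x⟩) (by simpa [B] using hx)
      fun ⟨z, hz⟩ => hij (Subtype.ext (Prod.ext_iff.1 (he hz)).1.symm)
  have hsF := isSymmetric_truncation hT F
  have hsQ := isSymmetric_truncation hT Q
  have h1 := card_mul_eigenvalueCount_sub_le he' hsQ (truncation_apply hTA Q) hsF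
    (truncation_apply hTA F) hK hK0 t
  have h2 := card_mul_sub_eigenvalueCount_le he' hsQ (truncation_apply hTA Q) hsF
    (truncation_apply hTA F) hK hK0 t
  have h3 := P.card_le_of_tiles he ht hQe
  have h4 := Fintype.card_le_of_injective e' he'
  have h5 := eigenvalueCount_le_finrank hsF t
  have hF0 : 0 < F.card := by
    rw [← hFcard]
    exact (Set.ncard_pos (P.finite_verts n)).2 (P.nonempty_verts n)
  rw [Nat.card_eq_fintype_card] at h3
  rw [hFcard] at h3 ⊢
  simp only [Fintype.card_prod, Fintype.card_coe, finrank_euclideanSpace] at h2 h4 h5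
  -- `spectralDistribution` unfolds to `eigenvalueCount` over the cardinality; what remains is `hB`.
  refine (abs_div_sub_div_le hQ.card_pos hF0 h5 h1 h2 h3 h4).trans ?_
  gcongr

theorem tendsto_ncard_nearConn_div
    (h : Tendsto (fun n => ((P.conn n).ncard : ℝ) / ((P.graph n).verts.ncard : ℝ)) atTop (𝓝 0))
    (r : ℕ) :
    Tendsto (fun n => ((P.nearConn n r).ncard : ℝ) / (P.graph n).verts.ncard) atTop (𝓝 0) := by
  refine squeeze_zero (fun n => by positivity) (fun n => ?_)
    (by simpa using h.mul_const (((d : ℝ) + 1) ^ r))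
  rw [div_mul_eq_mul_div]
  gcongr
  exact_mod_cast P.ncard_nearConn_le n r

end SelfSimilarPresentation

/-! ### Uniform convergence -/

/-- If the functions `f a` are up to `ε + C * w a` independent of `a`, for every `ε > 0` and some
`C` depending on `ε`, then they converge uniformly as `w a` tends to `0`. -/
theorem exists_forall_tendstoUniformly {α X : Type*} {s : Set α} {f : α → X → ℝ} {w : α → ℝ}
    (h : ∀ ε > 0, ∃ (g : X → ℝ) (C : ℝ), ∀ a ∈ s, ∀ t, |f a t - g t| ≤ ε + C * w a) :
    ∃ N : X → ℝ, ∀ u : ℕ → α, (∀ n, u n ∈ s) → Tendsto (fun n => w (u n)) atTop (𝓝 0) →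
      TendstoUniformly (fun n => f (u n)) N atTop := by
  have key : ∀ ε > 0, ∃ g : X → ℝ, ∀ u : ℕ → α, (∀ n, u n ∈ s) →
      Tendsto (fun n => w (u n)) atTop (𝓝 0) → ∀ᶠ n in atTop, ∀ t, |f (u n) t - g t| ≤ ε := by
    intro ε hε
    obtain ⟨g, C, hg⟩ := h (ε / 2) (by positivity)
    refine ⟨g, fun u hu hw => ?_⟩
    have hC : Tendsto (fun n => C * w (u n)) atTop (𝓝 0) := by simpa using hw.const_mul C
    filter_upwards [hC.eventually_lt_const (half_pos hε)] with n hn t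
    linarith [hg (u n) (hu n) t]
  by_cases hex : ∃ u : ℕ → α, (∀ n, u n ∈ s) ∧ Tendsto (fun n => w (u n)) atTop (𝓝 0)
  swap
  -- If no admissible sequence exists, any function serves as the limit.
  · exact ⟨0, fun u hu hw => absurd ⟨u, hu, hw⟩ hex⟩
  obtain ⟨v, hv, hvw⟩ := hex
  -- The limit is defined along one fixed sequence `v`. Any other sequence ends up near the same
  -- `g`, which depends only on `ε`, and so has the same limit.
  have hlim : ∀ t, ∃ l, Tendsto (fun n => f (v n) t) atTop (𝓝 l) := by
    refine fun t => cauchySeq_tendsto_of_complete (Metric.cauchySeq_iff'.2 fun ε hε => ?_)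
    obtain ⟨g, hg⟩ := key (ε / 3) (by positivity)
    obtain ⟨M, hM⟩ := eventually_atTop.1 (hg v hv hvw)
    refine ⟨M, fun n hn => ?_⟩
    have h1 := abs_le.1 (hM n hn t)
    have h2 := abs_le.1 (hM M le_rfl t)
    rw [Real.dist_eq, abs_lt]
    constructor <;> linarith [h1.1, h1.2, h2.1, h2.2]
  choose N hN using hlim
  refine ⟨N, fun u hu huw => Metric.tendstoUniformly_iff.2 fun ε hε => ?_⟩
  obtain ⟨g, hg⟩ := key (ε / 3) (by positivity)
  filter_upwards [hg u hu huw] with n hn t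
  have h1 : |N t - g t| ≤ ε / 3 :=
    le_of_tendsto ((hN t).sub_const (g t)).abs ((hg v hv hvw).mono fun m hm => hm t)
  have h1 := abs_le.1 h1
  have h2 := abs_le.1 (hn t)
  rw [Real.dist_eq, abs_lt]
  constructor <;> linarith [h1.1, h1.2, h2.1, h2.2]

theorem theorem4 {V : Type*} (G : SimpleGraph V) (hG : IsSelfSimilar G)
    (T : lp (fun _ : V => ℝ) 2 →L[ℝ] lp (fun _ : V => ℝ) 2)
    (hT : IsSelfAdjoint T) (hinv : IsPatternInvariant G T) :
    ∃ N : ℝ → ℝ, ∀ Q : ℕ → Finset V, IsFolnerSeq G Q →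
      TendstoUniformly (fun n => spectralDistribution (truncation T (Q n))) N atTop := by
  obtain ⟨d, k, P, hP⟩ := hG
  obtain ⟨r, A, hTA, hA0, hA⟩ := hinv
  obtain ⟨N, hN⟩ := exists_forall_tendstoUniformly (s := {Q : Finset V | Q.Nonempty})
    (f := fun Q => spectralDistribution (truncation T Q))
    (w := fun Q => ((innerBoundary G Q).ncard : ℝ) / (Q.card : ℝ)) fun ε hε => by
      -- The stage `n` depends only on `ε`, and the constant `C` is the number of vertices of `graph
      -- n`.
      obtain ⟨n, hn⟩ :=
        ((P.tendsto_ncard_nearConn_div hP r).eventually_lt_const hε).exists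
      refine ⟨spectralDistribution (truncation T (P.finite_verts n).toFinset),
        (P.graph n).verts.ncard, fun Q hQ t => ?_⟩
      exact (P.abs_spectralDistribution_sub_le hT hTA hA0 hA n hQ t).trans (by gcongr)
  exact ⟨N, fun Q hQ => hN Q hQ.1 hQ.2⟩
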